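/- Conventions. A cardinal $c$ is identified with the set of ordinals below $c$. Let $\lambda$ be a cardinal (only infinite regular $\lambda$ matters). A set $A\subseteq\lambda$ is bounded if some $\beta<\lambda$ satisfies $\zeta\le\beta$ for all $\zeta\in A$. For $C\subseteq\lambda$ let $\mathrm{acc}(C)$ be the set of limit ordinals $\delta<\lambda$ with $\delta=\sup(C\cap\delta)$. Define cardinals as follows. * $\mathfrak{dp}^{1+}_\lambda$ is the least cardinal $\theta$ for which there is no sequence $\langle C_\alpha:\alpha<\theta\rangle$ of closed unbounded subsets of $\lambda$ such that $|C_\beta\setminus C_\alpha|<\lambda$ whenever $\alpha<\beta<\theta$, and $C_{\alpha+1}\subseteq\mathrm{acc}(C_\alpha)$ whenever $\alpha+1<\theta$. * $\mathfrak{dp}^{2+}_\lambda$ is the least cardinal $\theta$ for which there is no sequence $\langle f_\alpha:\alpha<\theta\rangle$ of functions from $\lambda$ to $\lambda$ such that, whenever $\alpha<\beta<\theta$, the set $\{\zeta<\lambda: f_\alpha(\zeta)\ge f_\beta(\zeta)\}$ is bounded. * $\mathfrak{dp}^{3+}_\lambda$ is the least cardinal $\theta$ for which there is no sequence $\langle A_\alpha:\alpha<\theta\rangle$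 of unbounded subsets of $\lambda$ such that, whenever $\alpha<\beta<\theta$, the set $A_\beta\setminus A_\alpha$ is unbounded and the set $A_\alpha\setminus A_\beta$ is bounded. A filter on a regular uncountable cardinal $\kappa$ is normal if it is proper, contains all end segments of $\kappa$, and is closed under diagonal intersections. For a filter $D$ on $\kappa$ and cardinals $\theta_i$ $(i<\kappa)$, order $\prod_{i<\kappa}\theta_i$ by $f<_D g$ iff $\{i<\kappa: f(i)<g(i)\}\in D$. Then $\mathrm{Depth}^+(\prod_{i<\kappa}\theta_i/D)$ is the least cardinal $\chi$ such that $\prod_{i<\kappa}\theta_i$ contains no $<_D$-increasing sequence of length $\chi$, and $\theta=\mathrm{tcf}(\prod_{i<\kappa}\theta_i/D)$ means that $\theta$ is a regular cardinal and $\prod_{i<\kappa}\theta_i$ has a $<_D$-increasing $<_D$-cofinal sequence of length $\theta$. **Theorem.** Let $\kappa$ be a regular uncountable cardinal and $\ell\in\{1,2,3\}$. Let $\langle\mu_i:i<\kappa\rangle$ be a strictly increasing continuous sequence of cardinals with limit (supremum) $\mu$, and put $\lambda_i=\mu_i^+$ and $\lambda=\mu^+$. Assume that $2^\kappa<\mu$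 and that $\mu_i^\kappa<\mu$ for all $i<\kappa$. Let $D$ be a normal filter on $\kappa$, let $\theta_i$ $(i<\kappa)$ and $\theta$ be cardinals with $\theta_i<\mathfrak{dp}^{\ell+}_{\lambda_i}$ for all $i<\kappa$, and suppose that $\theta=\mathrm{tcf}(\prod_{i<\kappa}\theta_i/D)$ or just $\theta<\mathrm{Depth}^+(\prod_{i<\kappa}\theta_i/D)$. Then $\theta<\mathfrak{dp}^{\ell+}_\lambda$. -/

import Mathlib

open Cardinal

universe u

/-- The cardinal `c` regarded as a set, namely as the well-ordered set of all ordinals below `c`. -/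
abbrev CardSet (c : Cardinal.{u}) : Type u := c.ord.ToType

/-- `HasChain r χ`: there is a sequence `⟨a α : α < χ⟩` with `α < β → r (a α) (a β)`. -/
def HasChain {P : Type u} (r : P → P → Prop) (χ : Cardinal.{u}) : Prop :=
  ∃ a : CardSet χ → P, ∀ α β, α < β → r (a α) (a β)

/-- `Depth⁺(P)`, for `P` with strict order `r`: the least cardinal `χ` such that `P` has no
increasing sequence of length `χ`. -/
noncomputable def depthPlus {P : Type u} (r : P → P → Prop) : Cardinal.{u} :=
  sInf {χ | ¬ HasChain r χ}

/-- `tcf(P) = θ`, for `P` with strict order `r`: `θ` is a regular cardinal and `P` has an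
increasing cofinal sequence of length `θ`. -/
def IsTrueCofinality {P : Type u} (r : P → P → Prop) (θ : Cardinal.{u}) : Prop :=
  θ.IsRegular ∧ ∃ a : CardSet θ → P, (∀ α β, α < β → r (a α) (a β)) ∧ ∀ p, ∃ α, r p (a α)

/-- The relation `f <_D g` on the product `∏ i, θ i` of a family of cardinals:
`{i : f i < g i} ∈ D`. -/
def ProdLT {ι : Type u} (D : Filter ι) (θ : ι → Cardinal.{u}) (f g : ∀ i, CardSet (θ i)) : Prop :=
  ∀ᶠ i in D, f i < g i

/-- A normal filter: a proper filter that contains all end segments and is closed under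
diagonal intersections. -/
structure IsNormalFilter {ι : Type u} [LinearOrder ι] (D : Filter ι) : Prop where
  neBot : D.NeBot
  le_atTop : D ≤ Filter.atTop
  diag_mem : ∀ A : ι → Set ι, (∀ i, A i ∈ D) → {j | ∀ i, i < j → j ∈ A i} ∈ D

/-- `acc(C)`, the set of accumulation points of `C`: the `δ` with `δ = sup (C ∩ δ)`, where
`C ∩ δ` is nonempty (so that `δ` is a limit). -/
def accPoints {T : Type u} [LinearOrder T] (C : Set T) : Set T :=
  {δ | (C ∩ Set.Iio δ).Nonempty ∧ IsLUB (C ∩ Set.Iio δ) δ}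

/-- `⟨C α : α < θ⟩` is a sequence of clubs of `lam`, decreasing modulo sets of size `< lam`, with
`C (α + 1) ⊆ acc (C α)` whenever `α + 1 < θ`. -/
def IsClubChain (lam θ : Cardinal.{u}) (C : CardSet θ → Set (CardSet lam)) : Prop :=
  (∀ α, IsClub (C α)) ∧
  (∀ α β, α < β → #(C β \ C α : Set (CardSet lam)) < lam) ∧
  (∀ α β, α ⋖ β → C β ⊆ accPoints (C α))

/-- The first depth invariant of `lam`: the least `θ` for which there is no club chain of
length `θ`. -/
noncomputable def dpOnePlus (lam : Cardinal.{u}) : Cardinal.{u} :=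
  sInf {θ | ¬ ∃ C : CardSet θ → Set (CardSet lam), IsClubChain lam θ C}

/-- `f <_J g` for functions from `lam` to `lam`, where `J` is the ideal of bounded subsets of
`lam`. -/
def FunLT (lam : Cardinal.{u}) (f g : CardSet lam → CardSet lam) : Prop :=
  BddAbove {ζ | ¬ f ζ < g ζ}

/-- The second depth invariant of `lam`: the least `θ` for which there is no
`<_J`-increasing sequence of length `θ` of functions from `lam` to `lam`. -/
noncomputable def dpTwoPlus (lam : Cardinal.{u}) : Cardinal.{u} :=
  sInf {θ | ¬ HasChain (FunLT lam) θ}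

/-- `⟨A α : α < θ⟩` is a sequence of unbounded subsets of `lam` which is strictly increasing
modulo bounded sets. -/
def IsSetChain (lam θ : Cardinal.{u}) (A : CardSet θ → Set (CardSet lam)) : Prop :=
  (∀ α, ¬ BddAbove (A α)) ∧
  (∀ α β, α < β → ¬ BddAbove (A β \ A α) ∧ BddAbove (A α \ A β))

/-- The third depth invariant of `lam`: the least `θ` for which there is no sequence of length
`θ` of unbounded subsets of `lam` that is strictly increasing modulo bounded sets. -/
noncomputable def dpThreePlus (lam : Cardinal.{u}) : Cardinal.{u} :=
  sInf {θ | ¬ ∃ A : CardSet θ → Set (CardSet lam), IsSetChain lam θ A}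

/-- The depth invariants, indexed by `ℓ ∈ {1, 2, 3}` (no meaning for other `ℓ`). -/
noncomputable def dpPlus (ℓ : ℕ) (lam : Cardinal.{u}) : Cardinal.{u} :=
  match ℓ with
  | 1 => dpOnePlus lam
  | 2 => dpTwoPlus lam
  | 3 => dpThreePlus lam
  | _ => 0

/-! The bridge between the `λ_i = μ_i⁺` and `λ = μ⁺` is the Galvin–Hajnal norm: the rank of `g ∈ ∏
λ_i` under `<_D`, well-founded because a normal filter is countably complete. By continuity of the
`μ_i`, each function below `b` agrees, on the pieces of a regressive partition, with members of one
fixed family of size at most `μ` (`exists_small_family`). The norm is controlled by its values on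
these pieces, so only `2^κ · μ = μ` norms occur below `b`, and all norms are below `μ⁺`
(`prodNorm_lt_ord`). Conversely, a large norm forces a function above any given one modulo `D`
(`exists_norm_bound`), which yields a scale of length `μ⁺` (`exists_scale`). Thus "bounded in `λ`"
corresponds to "bounded coordinatewise modulo `D`". Now let `h_α` (`α < θ`) be increasing in `∏
θ_i`. For `ℓ = 1` take closures of the sets of norms of functions with values in the clubs indexed
by `h_α i`; for `ℓ = 2` take norms of coordinatewise values along the scale; for `ℓ = 3` take the
partial functions, out of a suitable family of size at most `μ⁺`, with values in the sets indexed by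
`h_α i`. -/

namespace CardSet

/-! ### Cardinals as well-orders; bounded versus small sets -/

open Set

variable {c : Cardinal.{u}}

theorem exists_forall_lt_of_mk_lt (hc : c.IsRegular) {s : Set (CardSet c)} (hs : #s < c) :
    ∃ b, ∀ x ∈ s, x < b := by
  have h : ¬ IsCofinal s := fun h => by
    have := Order.cof_le h
    rw [Ordinal.cof_toType, hc.cof_ord] at this
    exact absurd hs this.not_gt
  simpa [IsCofinal] using h

theorem exists_forall_lt (hc : c.IsRegular) {ι : Type u} (hι : #ι < c) (f : ι → CardSet c) :
    ∃ b, ∀ x, f x < b := by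
  obtain ⟨b, hb⟩ := exists_forall_lt_of_mk_lt hc (mk_range_le.trans_lt hι : #(range f) < c)
  exact ⟨b, fun x => hb _ (mem_range_self x)⟩

theorem mk_Iic_lt (hc : ℵ₀ ≤ c) (b : CardSet c) : #(Iic b) < c := by
  have := noMaxOrder hc
  obtain ⟨b', hb'⟩ := exists_gt b
  exact (mk_le_mk_of_subset (Iic_subset_Iio.2 hb')).trans_lt
    ((mk_Iio_lt b' (by simp)).trans_eq (mk_ord_toType c))

theorem mk_lt_of_bddAbove (hc : ℵ₀ ≤ c) {s : Set (CardSet c)} (hs : BddAbove s) : #s < c := by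
  obtain ⟨b, hb⟩ := hs
  exact (mk_le_mk_of_subset fun x hx => hb hx).trans_lt (mk_Iic_lt hc b)

theorem bddAbove_iff_mk_lt (hc : c.IsRegular) {s : Set (CardSet c)} : BddAbove s ↔ #s < c :=
  ⟨mk_lt_of_bddAbove hc.aleph0_le, fun h =>
    let ⟨b, hb⟩ := exists_forall_lt_of_mk_lt hc h
    ⟨b, fun x hx => (hb x hx).le⟩⟩

theorem not_bddAbove_univ (hc : ℵ₀ ≤ c) : ¬ BddAbove (univ : Set (CardSet c)) := by
  have := noMaxOrder hc
  have : Nonempty (CardSet c) := by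
    rw [Ordinal.nonempty_toType_iff]
    simpa using (aleph0_pos.trans_le hc).ne'
  exact _root_.not_bddAbove_univ

/-- The element of `CardSet c` given by an ordinal below `c`. -/
noncomputable def ofOrdinal (o : Ordinal.{u}) (ho : o < c.ord) : CardSet c :=
  Ordinal.ToType.mk ⟨o, ho⟩

/-- The ordinal below `c` given by an element of `CardSet c`. -/
noncomputable def toOrdinal (x : CardSet c) : Ordinal.{u} := (Ordinal.ToType.toOrd x).1

theorem toOrdinal_lt (x : CardSet c) : toOrdinal x < c.ord := (Ordinal.ToType.toOrd x).2

@[simp]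
theorem toOrdinal_ofOrdinal (o : Ordinal.{u}) (ho : o < c.ord) :
    toOrdinal (ofOrdinal o ho) = o := by
  simp [toOrdinal, ofOrdinal]

@[simp]
theorem toOrdinal_lt_toOrdinal {x y : CardSet c} : toOrdinal x < toOrdinal y ↔ x < y := by
  simp [toOrdinal]

@[simp]
theorem toOrdinal_le_toOrdinal {x y : CardSet c} : toOrdinal x ≤ toOrdinal y ↔ x ≤ y := by
  simp [toOrdinal]

theorem toOrdinal_injective : Function.Injective (toOrdinal (c := c)) := fun _ _ h =>
  le_antisymm (toOrdinal_le_toOrdinal.1 h.le) (toOrdinal_le_toOrdinal.1 h.ge)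

theorem exists_strictMono_of_le {c d : Cardinal.{u}} (h : c ≤ d) :
    ∃ f : CardSet c → CardSet d, StrictMono f :=
  ⟨fun x => ofOrdinal (toOrdinal x) ((toOrdinal_lt x).trans_le (ord_le_ord.2 h)), by
    intro x y hxy
    rw [← toOrdinal_lt_toOrdinal]
    simpa using hxy⟩

end CardSet

/-! ### Chains and least failing lengths -/

theorem HasChain.mono {P : Type u} {r : P → P → Prop} {χ χ' : Cardinal.{u}} (h : HasChain r χ)
    (hχ : χ' ≤ χ) : HasChain r χ' := by
  obtain ⟨a, ha⟩ := h
  obtain ⟨f, hf⟩ := CardSet.exists_strictMono_of_le hχ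
  exact ⟨a ∘ f, fun α β hαβ => ha _ _ (hf hαβ)⟩

theorem Cardinal.of_lt_sInf_not {p : Cardinal.{u} → Prop} {χ : Cardinal.{u}}
    (h : χ < sInf {χ | ¬ p χ}) : p χ :=
  by_contra fun hn => notMem_of_lt_csInf h (OrderBot.bddBelow _) hn

/-- A least failure of `p` lies above `θ` if `p` holds up to `θ` and fails somewhere. -/
theorem Cardinal.lt_sInf_not {p : Cardinal.{u} → Prop} {θ : Cardinal.{u}} (h : ∀ χ ≤ θ, p χ)
    (hn : ∃ χ, ¬ p χ) : θ < sInf {χ | ¬ p χ} := by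
  by_contra hle
  exact csInf_mem (s := {χ | ¬ p χ}) hn (h _ (not_lt.1 hle))

/-- If every sequence of length `χ` with a property `p` is injective, then some length has no
such sequence. -/
theorem Cardinal.exists_not_exists_of_injective {X : Type u}
    (p : ∀ χ : Cardinal.{u}, (CardSet χ → X) → Prop)
    (h : ∀ χ a, p χ a → ∀ α β, α < β → a α ≠ a β) : ∃ χ, ¬ ∃ a, p χ a := by
  refine ⟨Order.succ #X, fun ⟨a, ha⟩ => ?_⟩
  have hinj : Function.Injective a := fun α β hαβ => by
    by_contra hne
    rcases lt_or_gt_of_ne hne with hlt | hlt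
    · exact h _ a ha α β hlt hαβ
    · exact h _ a ha β α hlt hαβ.symm
  have := mk_le_of_injective hinj
  rw [mk_ord_toType] at this
  exact absurd this (Order.lt_succ _).not_ge

/-! ### Normal filters -/

namespace IsNormalFilter

open Filter

variable {ι : Type u} [LinearOrder ι] {D : Filter ι}

theorem eventually_diag (hD : IsNormalFilter D) {P : ι → ι → Prop} (h : ∀ i, ∀ᶠ j in D, P i j) :
    ∀ᶠ j in D, ∀ i < j, P i j :=
  hD.diag_mem (fun i => {j | P i j}) h

/-- Fodor's lemma for a normal filter. -/
theorem eventually_of_regressive (hD : IsNormalFilter D) {f : ι → ι} {P : ι → Prop}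
    (hf : ∀ᶠ i in D, f i < i) (h : ∀ j, ∀ᶠ i in D, f i = j → P i) : ∀ᶠ i in D, P i := by
  filter_upwards [hf, hD.eventually_diag h] with i hi hd using hd _ hi rfl

theorem eventually_ge (hD : IsNormalFilter D) (i : ι) : ∀ᶠ j in D, i ≤ j :=
  hD.le_atTop (eventually_ge_atTop i)

theorem eventually_gt (hD : IsNormalFilter D) [NoMaxOrder ι] (i : ι) : ∀ᶠ j in D, i < j :=
  hD.le_atTop (eventually_gt_atTop i)

theorem eventually_isSuccLimit (hD : IsNormalFilter D) [NoMaxOrder ι] [Nonempty ι] [SuccOrder ι] :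
    ∀ᶠ j in D, Order.IsSuccLimit j := by
  obtain ⟨i₀⟩ := ‹Nonempty ι›
  have h : ∀ i : ι, ∀ᶠ j in D, Order.succ i < j := fun i => hD.eventually_gt _
  filter_upwards [hD.eventually_gt i₀, hD.eventually_diag h] with j hj hd
  refine ⟨fun hmin => absurd (hmin hj.le) hj.not_ge, fun i hij => ?_⟩
  exact hij.2 (Order.lt_succ i) (hd i hij.lt)

theorem inf_principal (hD : IsNormalFilter D) {A : Set ι} (hA : ∃ᶠ i in D, i ∈ A) :
    IsNormalFilter (D ⊓ 𝓟 A) where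
  neBot := frequently_mem_iff_neBot.1 hA
  le_atTop := inf_le_left.trans hD.le_atTop
  diag_mem B hB := by
    simp only [mem_inf_principal] at hB ⊢
    filter_upwards [hD.diag_mem _ hB] with j hj hjA i hij using hj i hij hjA

/-- Countable completeness: spread the conditions along a strictly increasing sequence in `ι`;
beyond a bound of that sequence the diagonal intersection imposes all of them. -/
theorem eventually_all_nat (hD : IsNormalFilter D)
    (hι : ∀ e : ℕ → ι, ∃ b, ∀ n, e n < b) {P : ℕ → ι → Prop} (h : ∀ n, ∀ᶠ i in D, P n i) :
    ∀ᶠ i in D, ∀ n, P n i := by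
  have := hD.neBot
  obtain ⟨i₀, -⟩ := (h 0).exists
  have : ∃ e : ℕ → ι, StrictMono e := by
    have hgt : ∀ i : ι, ∃ j, i < j := fun i => (hι fun _ => i).imp fun b hb => hb 0
    choose f hf using hgt
    exact ⟨fun n => f^[n] i₀, strictMono_nat_of_lt_succ fun n => by
      rw [Function.iterate_succ_apply']; exact hf _⟩
  obtain ⟨e, he⟩ := this
  obtain ⟨b, hb⟩ := hι e
  have h' : ∀ j, ∀ᶠ i in D, ∀ n, e n = j → P n i := fun j => by
    by_cases hj : ∃ n, e n = j
    · obtain ⟨n, rfl⟩ := hj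
      filter_upwards [h n] with i hi m hm
      rwa [he.injective hm]
    · exact Eventually.of_forall fun i n hn => (hj ⟨n, hn⟩).elim
  filter_upwards [hD.eventually_diag h', hD.eventually_ge b] with i hi hbi n
  exact hi (e n) ((hb n).trans_le hbi) n rfl

end IsNormalFilter

/-! ### The Galvin–Hajnal norm -/

open Filter

section Norm

variable {ι : Type u} {c : ι → Cardinal.{u}} {E E' : Filter ι}

/-- The Galvin–Hajnal norm of `g`: its rank in the relation `<_E`. -/
noncomputable def prodNorm (hE : WellFounded (ProdLT E c)) (g : ∀ i, CardSet (c i)) :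
    Ordinal.{u} :=
  (hE.apply g).rank

theorem prodNorm_lt (hE : WellFounded (ProdLT E c)) {f g : ∀ i, CardSet (c i)}
    (h : ProdLT E c f g) : prodNorm hE f < prodNorm hE g :=
  Acc.rank_lt_of_rel _ h

theorem le_prodNorm (hE : WellFounded (ProdLT E c)) {g : ∀ i, CardSet (c i)} {o : Ordinal.{u}}
    (h : ∀ γ < o, ∃ g', ProdLT E c g' g ∧ γ ≤ prodNorm hE g') : o ≤ prodNorm hE g := by
  by_contra hlt
  obtain ⟨g', hg', hle⟩ := h _ (not_le.1 hlt)
  exact absurd (prodNorm_lt hE hg') hle.not_gt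

theorem exists_le_prodNorm (hE : WellFounded (ProdLT E c)) {g : ∀ i, CardSet (c i)}
    {o : Ordinal.{u}} (h : o < prodNorm hE g) :
    ∃ g', ProdLT E c g' g ∧ o ≤ prodNorm hE g' := by
  rw [prodNorm, Acc.rank_eq, Ordinal.lt_iSup_iff] at h
  obtain ⟨⟨g', hg'⟩, h⟩ := h
  exact ⟨g', hg', Order.lt_succ_iff.1 h⟩

theorem ProdLT.trans {f g h : ∀ i, CardSet (c i)} (hfg : ProdLT E c f g) (hgh : ProdLT E c g h) :
    ProdLT E c f h := by
  filter_upwards [hfg, hgh] with i h₁ h₂ using h₁.trans h₂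

/-- Since `<_E` is transitive, descending from `g` to a rank equal to `o` never leaves the functions
below `g`. -/
theorem exists_prodNorm_eq (hE : WellFounded (ProdLT E c)) {o : Ordinal.{u}}
    (g : ∀ i, CardSet (c i)) (h : o < prodNorm hE g) :
    ∃ g', ProdLT E c g' g ∧ prodNorm hE g' = o := by
  induction g using hE.induction with
  | _ g ih =>
    obtain ⟨g', hg', hle⟩ := exists_le_prodNorm hE h
    rcases hle.eq_or_lt with rfl | hlt
    · exact ⟨g', hg', rfl⟩
    · obtain ⟨g'', hg'', heq⟩ := ih g' hg' hlt
      exact ⟨g'', hg''.trans hg', heq⟩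

theorem prodNorm_mono (hE : WellFounded (ProdLT E c)) {f g : ∀ i, CardSet (c i)}
    (h : ∀ᶠ i in E, f i ≤ g i) : prodNorm hE f ≤ prodNorm hE g := by
  refine le_prodNorm hE fun γ hγ => ?_
  obtain ⟨f', hf', hle⟩ := exists_le_prodNorm hE hγ
  refine ⟨f', ?_, hle⟩
  filter_upwards [h, hf'] with i h₁ h₂ using h₂.trans_le h₁

theorem prodNorm_congr (hE : WellFounded (ProdLT E c)) {f g : ∀ i, CardSet (c i)}
    (h : ∀ᶠ i in E, f i = g i) : prodNorm hE f = prodNorm hE g :=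
  (prodNorm_mono hE (h.mono fun _ hi => hi.le)).antisymm
    (prodNorm_mono hE (h.mono fun _ hi => hi.ge))

/-- A finer filter makes more pairs comparable, so ranks can only grow. -/
theorem prodNorm_anti (hE : WellFounded (ProdLT E c)) (hE' : WellFounded (ProdLT E' c))
    (hle : E' ≤ E) (g : ∀ i, CardSet (c i)) : prodNorm hE g ≤ prodNorm hE' g := by
  induction g using hE.induction with
  | _ g ih =>
    refine le_prodNorm hE' fun γ hγ => ?_
    obtain ⟨f, hf, hle'⟩ := exists_le_prodNorm hE hγ
    exact ⟨f, hle hf, hle'.trans (ih f hf)⟩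

end Norm

namespace IsNormalFilter

variable {ι : Type u} [LinearOrder ι] {E : Filter ι}

theorem wellFounded_prodLT (hE : IsNormalFilter E) (hι : ∀ e : ℕ → ι, ∃ b, ∀ n, e n < b)
    (c : ι → Cardinal.{u}) : WellFounded (ProdLT E c) := by
  rw [wellFounded_iff_isEmpty_descending_chain]
  refine ⟨fun ⟨f, hf⟩ => ?_⟩
  have := hE.neBot
  obtain ⟨i, hi⟩ := (hE.eventually_all_nat hι hf).exists
  exact (wellFounded_iff_isEmpty_descending_chain.1
    (wellFounded_lt (α := CardSet (c i)))).false ⟨fun n => f n i, hi⟩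

variable {c : ι → Cardinal.{u}}

/-- The Galvin–Hajnal norm is at least the minimum of the norms on the pieces of a partition
given by a regressive function. -/
theorem le_prodNorm_of_regressive (hE : IsNormalFilter E) (hι : ∀ e : ℕ → ι, ∃ b, ∀ n, e n < b)
    {h : ι → ι} (hh : ∀ᶠ i in E, h i < i) (o : Ordinal.{u}) (g : ∀ i, CardSet (c i))
    (H : ∀ j (hj : ∃ᶠ i in E, i ∈ {i | h i = j}),
      o ≤ prodNorm ((hE.inf_principal hj).wellFounded_prodLT hι c) g) :
    o ≤ prodNorm (hE.wellFounded_prodLT hι c) g := by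
  induction o using WellFoundedLT.induction generalizing g with
  | _ o ih =>
    refine le_prodNorm _ fun γ hγ => ?_
    have key : ∀ j, ∃ g' : ∀ i, CardSet (c i), (∀ᶠ i in E, h i = j → g' i < g i) ∧
        ∀ hj : ∃ᶠ i in E, i ∈ {i | h i = j},
          γ ≤ prodNorm ((hE.inf_principal hj).wellFounded_prodLT hι c) g' := fun j => by
      by_cases hj : ∃ᶠ i in E, i ∈ {i | h i = j}
      · obtain ⟨g', hg', hle⟩ := exists_le_prodNorm _ (hγ.trans_le (H j hj))
        exact ⟨g', mem_inf_principal.1 hg', fun _ => hle⟩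
      · refine ⟨g, ?_, fun hj' => absurd hj' hj⟩
        filter_upwards [not_frequently.1 hj] with i hi hi' using absurd hi' hi
    choose G hG hGn using key
    refine ⟨fun i => G (h i) i, ?_, ih γ hγ _ fun j hj => ?_⟩
    · exact hE.eventually_of_regressive hh fun j => by
        filter_upwards [hG j] with i hi hij
        subst hij; exact hi rfl
    · refine (hGn j hj).trans (prodNorm_mono _ ?_)
      filter_upwards [mem_inf_of_right (mem_principal_self _)] with i hi
      rw [show h i = j from hi]

end IsNormalFilter

/-! ### Norms and scales in the product of successors -/

theorem Cardinal.mk_setOf_forall_mem_le {ι : Type u} {X : ι → Type u} (S : ∀ i, Set (X i))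
    (ν : Cardinal.{u}) (h : ∀ i, #(S i) ≤ ν) : #{g : ∀ i, X i | ∀ i, g i ∈ S i} ≤ ν ^ #ι := by
  have hinj : Function.Injective
      (fun (g : {g : ∀ i, X i | ∀ i, g i ∈ S i}) (i : ι) => (⟨g.1 i, g.2 i⟩ : S i)) := by
    intro g g' hgg
    ext i
    exact congrArg Subtype.val (congrFun hgg i)
  refine (mk_le_of_injective hinj).trans ?_
  rw [mk_pi, ← prod_const']
  exact prod_le_prod _ _ h

/-- The hypotheses on the cardinals `μs i` and their limit `μ`. -/
structure IsPowerSequence (κ : Cardinal.{u}) (μs : CardSet κ → Cardinal.{u})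
    (μ : Cardinal.{u}) : Prop where
  isRegular : κ.IsRegular
  aleph0_lt : ℵ₀ < κ
  strictMono : StrictMono μs
  isLUB_of_isSuccLimit : ∀ i, Order.IsSuccLimit i → IsLUB (μs '' Set.Iio i) (μs i)
  isLUB_range : IsLUB (Set.range μs) μ
  two_power_lt : 2 ^ κ < μ
  power_lt : ∀ i, μs i ^ κ < μ

namespace IsPowerSequence

variable {κ : Cardinal.{u}} {μs : CardSet κ → Cardinal.{u}} {μ : Cardinal.{u}}

theorem exists_nat_bound (hP : IsPowerSequence κ μs μ) (e : ℕ → CardSet κ) :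
    ∃ b, ∀ n, e n < b := by
  obtain ⟨b, hb⟩ := CardSet.exists_forall_lt_of_mk_lt hP.isRegular
    ((Set.countable_range e).le_aleph0.trans_lt hP.aleph0_lt)
  exact ⟨b, fun n => hb _ (Set.mem_range_self n)⟩

theorem noMaxOrder (hP : IsPowerSequence κ μs μ) : NoMaxOrder (CardSet κ) :=
  Cardinal.noMaxOrder hP.isRegular.aleph0_le

theorem nonempty (hP : IsPowerSequence κ μs μ) : Nonempty (CardSet κ) := by
  rw [Ordinal.nonempty_toType_iff]
  simpa using hP.isRegular.ne_zero

theorem card_lt (hP : IsPowerSequence κ μs μ) : κ < μ := (cantor κ).trans hP.two_power_lt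

theorem aleph0_le (hP : IsPowerSequence κ μs μ) : ℵ₀ ≤ μ := (hP.aleph0_lt.trans hP.card_lt).le

theorem isRegular_succ (hP : IsPowerSequence κ μs μ) : (Order.succ μ).IsRegular :=
  Cardinal.isRegular_succ hP.aleph0_le

theorem eventually_aleph0_le (hP : IsPowerSequence κ μs μ) {D : Filter (CardSet κ)}
    (hD : IsNormalFilter D) : ∀ᶠ i in D, ℵ₀ ≤ μs i := by
  obtain ⟨_, ⟨i, rfl⟩, hi⟩ := (lt_isLUB_iff hP.isLUB_range).1 (hP.aleph0_lt.trans hP.card_lt)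
  filter_upwards [hD.eventually_ge i] with j hj using hi.le.trans (hP.strictMono.monotone hj)

theorem nonempty_cardSet (i : CardSet κ) : Nonempty (CardSet (Order.succ (μs i))) := by
  rw [Ordinal.nonempty_toType_iff]
  simp

/-- Functions below `b` split, along a regressive function, into pieces of at most `μ` functions. -/
theorem exists_small_family (hP : IsPowerSequence κ μs μ)
    (b : ∀ i, CardSet (Order.succ (μs i))) :
    ∃ 𝒢 : Set (∀ i, CardSet (Order.succ (μs i))), #𝒢 ≤ μ ∧
      ∀ (E : Filter (CardSet κ)), IsNormalFilter E → ∀ g : ∀ i, CardSet (Order.succ (μs i)),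
        (∀ᶠ i in E, g i ≤ b i) → ∃ (h : CardSet κ → CardSet κ)
          (G : CardSet κ → ∀ i, CardSet (Order.succ (μs i))),
          (∀ᶠ i in E, h i < i) ∧ (∀ j, G j ∈ 𝒢) ∧ ∀ᶠ i in E, g i = G (h i) i := by
  classical
  have := hP.noMaxOrder
  have := hP.nonempty
  have hemb : ∀ i, Nonempty (Set.Iio (b i) ↪ CardSet (μs i)) := fun i => by
    have h := (mk_Iio_lt (b i) (by simp)).trans_eq (mk_ord_toType _)
    rw [Order.lt_succ_iff] at h
    rw [← Cardinal.le_def, mk_ord_toType]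
    exact h
  let e := fun i => (hemb i).some
  -- The values below `b i` with code below `μ_j`. Adding `b i` covers `g i = b i` and provides a
  -- default value.
  let S : CardSet κ → ∀ i, Set (CardSet (Order.succ (μs i))) := fun j i =>
    insert (b i) {y | ∃ hy : y < b i, CardSet.toOrdinal (e i ⟨y, hy⟩) < (μs j).ord}
  have hS : ∀ j i, #(S j i) ≤ μs j + 1 := fun j i => by
    refine (mk_insert_le).trans (add_le_add_left ?_ 1)
    have hinj : Function.Injective
        (fun y : {y | ∃ hy : y < b i, CardSet.toOrdinal (e i ⟨y, hy⟩) < (μs j).ord} =>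
          (CardSet.ofOrdinal _ y.2.2 : CardSet (μs j))) := by
      intro y z hyz
      have := congrArg CardSet.toOrdinal hyz
      simp only [CardSet.toOrdinal_ofOrdinal] at this
      have := (e i).injective (CardSet.toOrdinal_injective this)
      exact Subtype.ext (Subtype.mk.inj this)
    simpa using mk_le_of_injective hinj
  refine ⟨⋃ j, {g | ∀ i, g i ∈ S j i}, ?_, fun E hE g hg => ?_⟩
  · refine (mk_iUnion_le _).trans ?_
    rw [mk_ord_toType]
    refine (mul_le_mul' hP.card_lt.le (ciSup_le' fun j => ?_)).trans
      (mul_eq_self hP.aleph0_le).le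
    refine (mk_setOf_forall_mem_le _ _ (hS j)).trans ?_
    rw [mk_ord_toType]
    refine (power_le_power_right ?_).trans (hP.power_lt (Order.succ j)).le
    exact add_one_le_of_lt (hP.strictMono (Order.lt_succ j))
  -- At a limit `i` continuity puts the code of `g i`, an ordinal below `μ_i`, below some `μ_j` with
  -- `j < i`: this `j` is the regressive choice.
  · have hlim : ∀ i, Order.IsSuccLimit i → g i ≤ b i → ∃ j < i, g i ∈ S j i := fun i hi hgb => by
      rcases hgb.eq_or_lt with heq | hlt
      · obtain ⟨j, hj⟩ := not_isMin_iff.1 hi.not_isMin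
        exact ⟨j, hj, Or.inl heq⟩
      · have h := lt_ord.1 (CardSet.toOrdinal_lt (e i ⟨g i, hlt⟩))
        obtain ⟨_, ⟨j, hj, rfl⟩, hjlt⟩ := (lt_isLUB_iff (hP.isLUB_of_isSuccLimit i hi)).1 h
        exact ⟨j, hj, Or.inr ⟨hlt, lt_ord.2 hjlt⟩⟩
    let h : CardSet κ → CardSet κ := fun i =>
      if H : ∃ j < i, g i ∈ S j i then H.choose else i
    have hh : ∀ᶠ i in E, h i < i ∧ g i ∈ S (h i) i := by
      filter_upwards [hE.eventually_isSuccLimit, hg] with i hi hgb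
      have H := hlim i hi hgb
      simp only [h, dif_pos H]
      exact H.choose_spec
    refine ⟨h, fun j i => if g i ∈ S j i then g i else b i, hh.mono fun _ hi => hi.1,
      fun j => Set.mem_iUnion.2 ⟨j, fun i => ?_⟩, hh.mono fun i hi => (if_pos hi.2).symm⟩
    dsimp only
    split_ifs with hi
    · exact hi
    · exact Or.inl rfl

theorem wellFounded (hP : IsPowerSequence κ μs μ) {E : Filter (CardSet κ)}
    (hE : IsNormalFilter E) : WellFounded (ProdLT E fun i => Order.succ (μs i)) :=
  hE.wellFounded_prodLT hP.exists_nat_bound _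

/-- Otherwise every `x < μ⁺` is the norm of some `f` below `g`. On some piece the restricted norm of
`f` is still `x`, so `x` is determined by a subset of `κ` and a member of the small family, leaving
only `μ` possibilities. -/
theorem prodNorm_lt_ord (hP : IsPowerSequence κ μs μ) {E : Filter (CardSet κ)}
    (hE : IsNormalFilter E) (g : ∀ i, CardSet (Order.succ (μs i))) :
    prodNorm (hP.wellFounded hE) g < (Order.succ μ).ord := by
  classical
  by_contra! hle
  obtain ⟨𝒢, h𝒢, hfam⟩ := hP.exists_small_family g
  let Φ : Set (CardSet κ) × 𝒢 → Ordinal.{u} := fun p =>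
    if hB : ∃ᶠ i in E, i ∈ p.1 then prodNorm (hP.wellFounded (hE.inf_principal hB)) p.2.1 else 0
  have hΦ : ∀ x : CardSet (Order.succ μ), ∃ p, Φ p = CardSet.toOrdinal x := fun x => by
    obtain ⟨f, hf, hfx⟩ := exists_prodNorm_eq (hP.wellFounded hE) g
      ((CardSet.toOrdinal_lt x).trans_le hle)
    obtain ⟨h, G, hh, hG, hfG⟩ := hfam E hE f (hf.mono fun _ hi => hi.le)
    have : ∃ j, ∃ hj : ∃ᶠ i in E, i ∈ {i | h i = j},
        prodNorm (hP.wellFounded (hE.inf_principal hj)) f ≤ CardSet.toOrdinal x := by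
      by_contra! hcon
      have := hE.le_prodNorm_of_regressive hP.exists_nat_bound hh
        (Order.succ (CardSet.toOrdinal x)) f fun j hj => Order.succ_le_of_lt (hcon j hj)
      exact absurd ((Order.lt_succ _).trans_le this) hfx.not_gt
    obtain ⟨j, hj, hle'⟩ := this
    refine ⟨({i | h i = j}, ⟨G j, hG j⟩), ?_⟩
    simp only [Φ]
    rw [dif_pos hj, ← hle'.antisymm]
    · refine prodNorm_congr _ ?_
      filter_upwards [mem_inf_of_left hfG, mem_inf_of_right (mem_principal_self _)] with i hi hij
      rw [hi, show h i = j from hij]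
    · rw [← hfx]
      exact prodNorm_anti _ _ inf_le_left _
  choose p hp using hΦ
  have hinj : Function.Injective p := fun x y hxy =>
    CardSet.toOrdinal_injective (by rw [← hp, ← hp, hxy])
  have hcard := mk_le_of_injective hinj
  rw [mk_ord_toType, mk_prod, lift_id, lift_id, mk_set, mk_ord_toType] at hcard
  refine absurd (hcard.trans ((mul_le_mul' hP.two_power_lt.le h𝒢).trans
    (mul_eq_self hP.aleph0_le).le)) (Order.lt_succ _).not_ge

/-- The Galvin–Hajnal norm, as an element of `CardSet μ⁺`. -/
noncomputable def norm (hP : IsPowerSequence κ μs μ) {D : Filter (CardSet κ)}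
    (hD : IsNormalFilter D) (g : ∀ i, CardSet (Order.succ (μs i))) : CardSet (Order.succ μ) :=
  CardSet.ofOrdinal _ (hP.prodNorm_lt_ord hD g)

theorem toOrdinal_norm (hP : IsPowerSequence κ μs μ) {D : Filter (CardSet κ)}
    (hD : IsNormalFilter D) (g : ∀ i, CardSet (Order.succ (μs i))) :
    CardSet.toOrdinal (hP.norm hD g) = prodNorm (hP.wellFounded hD) g :=
  CardSet.toOrdinal_ofOrdinal _ _

theorem norm_lt (hP : IsPowerSequence κ μs μ) {D : Filter (CardSet κ)} (hD : IsNormalFilter D)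
    {f g : ∀ i, CardSet (Order.succ (μs i))} (h : ProdLT D _ f g) :
    hP.norm hD f < hP.norm hD g := by
  rw [← CardSet.toOrdinal_lt_toOrdinal, toOrdinal_norm, toOrdinal_norm]
  exact prodNorm_lt _ h

theorem norm_mono (hP : IsPowerSequence κ μs μ) {D : Filter (CardSet κ)} (hD : IsNormalFilter D)
    {f g : ∀ i, CardSet (Order.succ (μs i))} (h : ∀ᶠ i in D, f i ≤ g i) :
    hP.norm hD f ≤ hP.norm hD g := by
  rw [← CardSet.toOrdinal_le_toOrdinal, toOrdinal_norm, toOrdinal_norm]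
  exact prodNorm_mono _ h

theorem exists_norm_eq (hP : IsPowerSequence κ μs μ) {D : Filter (CardSet κ)}
    (hD : IsNormalFilter D) {g : ∀ i, CardSet (Order.succ (μs i))} {x : CardSet (Order.succ μ)}
    (h : x < hP.norm hD g) : ∃ g', ProdLT D _ g' g ∧ hP.norm hD g' = x := by
  rw [← CardSet.toOrdinal_lt_toOrdinal, toOrdinal_norm] at h
  obtain ⟨g', hg', heq⟩ := exists_prodNorm_eq _ g h
  exact ⟨g', hg', CardSet.toOrdinal_injective ((hP.toOrdinal_norm hD g').trans heq)⟩

/-- A function of large norm lies above a given function. -/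
theorem exists_norm_bound (hP : IsPowerSequence κ μs μ) {D : Filter (CardSet κ)}
    (hD : IsNormalFilter D) (b : ∀ i, CardSet (Order.succ (μs i))) :
    ∃ γ : CardSet (Order.succ μ), ∀ g, γ ≤ hP.norm hD g → ProdLT D _ b g := by
  classical
  have hγ : ∃ γ : CardSet (Order.succ μ), ∀ (A : Set (CardSet κ)) (hA : ∃ᶠ i in D, i ∈ A),
      prodNorm (hP.wellFounded (hD.inf_principal hA)) b < CardSet.toOrdinal γ := by
    -- There are at most `2^κ < μ⁺` positive sets, so one `γ` exceeds the norm of `b` over all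
    -- restrictions of `D`.
    obtain ⟨γ, hγ⟩ := CardSet.exists_forall_lt hP.isRegular_succ
      (ι := {A : Set (CardSet κ) // ∃ᶠ i in D, i ∈ A}) (by
        refine (mk_subtype_le _).trans_lt ?_
        rw [mk_set, mk_ord_toType]
        exact hP.two_power_lt.trans (Order.lt_succ _))
      fun A => CardSet.ofOrdinal _ (hP.prodNorm_lt_ord (hD.inf_principal A.2) b)
    refine ⟨γ, fun A hA => ?_⟩
    have := hγ ⟨A, hA⟩
    rwa [← CardSet.toOrdinal_lt_toOrdinal, CardSet.toOrdinal_ofOrdinal] at this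
  obtain ⟨γ, hγ⟩ := hγ
  refine ⟨γ, fun g hg => ?_⟩
  rw [← CardSet.toOrdinal_le_toOrdinal, toOrdinal_norm] at hg
  by_contra hn
  have hA : ∃ᶠ i in D, i ∈ {i | ¬ b i < g i} := not_eventually.1 hn
  refine absurd hg (not_le.2 (lt_of_le_of_lt ?_ (hγ _ hA)))
  refine (prodNorm_anti _ (hP.wellFounded (hD.inf_principal hA)) inf_le_left g).trans
    (prodNorm_mono _ ?_)
  filter_upwards [mem_inf_of_right (mem_principal_self _)] with i hi using not_lt.1 hi

/-- Number the functions by ordinals below `μ`. At coordinate `i` bound only those numbered below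
`μ_i`, possible as `μ_i⁺` is regular for infinite `μ_i`; each function is caught from some
coordinate on. -/
theorem exists_upper_bound (hP : IsPowerSequence κ μs μ) {D : Filter (CardSet κ)}
    (hD : IsNormalFilter D) {T : Type u} (hT : #T ≤ μ)
    (f : T → ∀ i, CardSet (Order.succ (μs i))) : ∃ b, ∀ x, ProdLT D _ (f x) b := by
  have he : Nonempty (T ↪ CardSet μ) := by
    rw [← Cardinal.le_def, mk_ord_toType]; exact hT
  obtain ⟨e⟩ := he
  have hb : ∀ i, ∃ b : CardSet (Order.succ (μs i)), ℵ₀ ≤ μs i →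
      ∀ x, CardSet.toOrdinal (e x) < (μs i).ord → f x i < b := fun i => by
    by_cases hi : ℵ₀ ≤ μs i
    · have hinj : Function.Injective
          (fun x : {x | CardSet.toOrdinal (e x) < (μs i).ord} =>
            (CardSet.ofOrdinal (CardSet.toOrdinal (e x.1)) x.2 : CardSet (μs i))) := by
        intro x y hxy
        have := congrArg CardSet.toOrdinal hxy
        simp only [CardSet.toOrdinal_ofOrdinal] at this
        exact Subtype.ext (e.injective (CardSet.toOrdinal_injective this))
      have hle := mk_le_of_injective hinj
      rw [mk_ord_toType] at hle
      obtain ⟨b, hb⟩ := CardSet.exists_forall_lt (Cardinal.isRegular_succ hi)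
        (Order.lt_succ_iff.2 hle) fun x => f x.1 i
      exact ⟨b, fun _ x hx => hb ⟨x, hx⟩⟩
    · exact ⟨(nonempty_cardSet i).some, fun h => absurd h hi⟩
  choose b hb using hb
  refine ⟨b, fun x => ?_⟩
  obtain ⟨_, ⟨j, rfl⟩, hj⟩ := (lt_isLUB_iff hP.isLUB_range).1
    (lt_ord.1 (CardSet.toOrdinal_lt (e x)))
  filter_upwards [hP.eventually_aleph0_le hD, hD.eventually_ge j] with i hi hji
  exact hb i hi x (lt_ord.2 (hj.trans_le (hP.strictMono.monotone hji)))

/-- There is a scale of length `μ⁺` in the product of the `(μs i)⁺`, with large norms. -/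
theorem exists_scale (hP : IsPowerSequence κ μs μ) {D : Filter (CardSet κ)}
    (hD : IsNormalFilter D) :
    ∃ f : CardSet (Order.succ μ) → ∀ i, CardSet (Order.succ (μs i)),
      (∀ s t, s < t → ProdLT D _ (f s) (f t)) ∧
      (∀ s, s ≤ hP.norm hD (f s)) ∧
      ∀ b, ∃ s₀, ∀ s, s₀ ≤ s → ProdLT D _ b (f s) := by
  have hbd : ∀ (s : CardSet (Order.succ μ))
      (f : ∀ t, t < s → ∀ i, CardSet (Order.succ (μs i))),
      ∃ b, ∀ t (ht : t < s), ProdLT D _ (f t ht) b := fun s f => by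
    obtain ⟨b, hb⟩ := hP.exists_upper_bound hD (T := Set.Iio s)
      (Order.lt_succ_iff.1 ((mk_Iio_lt s (by simp)).trans_eq (mk_ord_toType _)))
      fun t => f t.1 t.2
    exact ⟨b, fun t ht => hb ⟨t, ht⟩⟩
  choose F hF using hbd
  let f := (wellFounded_lt (α := CardSet (Order.succ μ))).fix F
  have hmono : ∀ s t, s < t → ProdLT D _ (f s) (f t) := fun s t hst => by
    have : f t = F t fun t _ => f t := WellFounded.fix_eq _ _ _
    rw [this]
    exact hF t (fun t _ => f t) s hst
  have hnorm : ∀ s, s ≤ hP.norm hD (f s) := fun s => by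
    induction s using WellFoundedLT.induction with
    | _ s ih =>
      rw [← CardSet.toOrdinal_le_toOrdinal, toOrdinal_norm]
      refine le_prodNorm _ fun γ hγ => ?_
      let t : CardSet (Order.succ μ) := CardSet.ofOrdinal γ (hγ.trans (CardSet.toOrdinal_lt s))
      have ht : CardSet.toOrdinal t = γ := CardSet.toOrdinal_ofOrdinal _ _
      have hts : t < s := by rw [← CardSet.toOrdinal_lt_toOrdinal, ht]; exact hγ
      refine ⟨f t, hmono t s hts, ?_⟩
      rw [← ht, ← hP.toOrdinal_norm hD]
      exact CardSet.toOrdinal_le_toOrdinal.2 (ih t hts)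
  refine ⟨f, hmono, hnorm, fun b => ?_⟩
  obtain ⟨γ, hγ⟩ := hP.exists_norm_bound hD b
  exact ⟨γ, fun s hs => hγ _ (hs.trans (hnorm s))⟩

end IsPowerSequence

/-! ### Accumulation points and clubs -/

theorem mem_accPoints_iff {T : Type u} [LinearOrder T] {C : Set T} {δ : T} :
    δ ∈ accPoints C ↔ (∃ ν ∈ C, ν < δ) ∧ ∀ η < δ, ∃ ν ∈ C, η < ν ∧ ν < δ := by
  refine and_congr Iff.rfl ⟨fun h η hη => ?_, fun h => ⟨fun ν hν => hν.2.le, fun η hη => ?_⟩⟩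
  · obtain ⟨ν, ⟨hν, hνδ⟩, hην⟩ := (lt_isLUB_iff h).1 hη
    exact ⟨ν, hν, hην, hνδ⟩
  · by_contra hlt
    obtain ⟨ν, hν, hην, hνδ⟩ := h η (not_le.1 hlt)
    exact absurd (hη ⟨hν, hνδ⟩) hην.not_ge

section Club

variable {T : Type u} [LinearOrder T] {C S : Set T}

theorem accPoints_mono (h : S ⊆ C) : accPoints S ⊆ accPoints C := fun δ hδ => by
  rw [mem_accPoints_iff] at hδ ⊢
  exact ⟨hδ.1.imp fun ν hν => ⟨h hν.1, hν.2⟩,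
    fun η hη => (hδ.2 η hη).imp fun ν hν => ⟨h hν.1, hν.2⟩⟩

theorem IsClub.accPoints_subset (h : IsClub C) : accPoints C ⊆ C := fun _ hδ =>
  h.isLUB_mem Set.inter_subset_left hδ.1 hδ.2

theorem isClub_of_accPoints_subset (h : accPoints C ⊆ C) (hC : IsCofinal C) : IsClub C where
  isCofinal := hC
  dirSupClosed d hd hne _ a ha := by
    by_cases had : a ∈ d
    · exact hd had
    · have hlt : ∀ x ∈ d, x < a := fun x hx =>
        (ha.1 hx).lt_of_ne fun hxa => had (hxa ▸ hx)
      refine h (mem_accPoints_iff.2 ⟨?_, fun η hη => ?_⟩)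
      · obtain ⟨x, hx⟩ := hne
        exact ⟨x, hd hx, hlt x hx⟩
      · obtain ⟨x, hx, hηx⟩ := (lt_isLUB_iff ha).1 hη
        exact ⟨x, hd hx, hηx, hlt x hx⟩

theorem accPoints_union_accPoints : accPoints (S ∪ accPoints S) ⊆ accPoints S := fun δ hδ => by
  rw [mem_accPoints_iff] at hδ ⊢
  refine ⟨?_, fun η hη => ?_⟩
  · obtain ⟨ν, hν | hν, hνδ⟩ := hδ.1
    · exact ⟨ν, hν, hνδ⟩
    · obtain ⟨ν', hν', hlt⟩ := (mem_accPoints_iff.1 hν).1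
      exact ⟨ν', hν', hlt.trans hνδ⟩
  · obtain ⟨ν, hν | hν, hην, hνδ⟩ := hδ.2 η hη
    · exact ⟨ν, hν, hην, hνδ⟩
    · obtain ⟨ν', hν', hlt, hlt'⟩ := (mem_accPoints_iff.1 hν).2 η hην
      exact ⟨ν', hν', hlt, hlt'.trans hνδ⟩

theorem isClub_union_accPoints (hS : IsCofinal S) : IsClub (S ∪ accPoints S) :=
  isClub_of_accPoints_subset
    (accPoints_union_accPoints.trans Set.subset_union_right) (hS.mono Set.subset_union_left)

theorem IsClub.inter_Ioi [NoMaxOrder T] (h : IsClub C) (t : T) : IsClub (C ∩ Set.Ioi t) := by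
  refine isClub_of_accPoints_subset (fun δ hδ => ?_) fun x => ?_
  · refine ⟨h.accPoints_subset (accPoints_mono Set.inter_subset_left hδ), ?_⟩
    obtain ⟨ν, hν, hνδ⟩ := (mem_accPoints_iff.1 hδ).1
    exact lt_trans hν.2 hνδ
  · obtain ⟨y, hy⟩ := exists_gt (max x t)
    obtain ⟨z, hz, hyz⟩ := h.isCofinal y
    exact ⟨z, ⟨hz, (le_max_right _ _).trans_lt (hy.trans_le hyz)⟩,
      (le_max_left _ _).trans (hy.le.trans hyz)⟩

theorem mem_accPoints_inter_Ioi {δ t : T} (h : δ ∈ accPoints C) (ht : t < δ) :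
    δ ∈ accPoints (C ∩ Set.Ioi t) := by
  rw [mem_accPoints_iff] at h ⊢
  have key : ∀ η < δ, ∃ ν ∈ C ∩ Set.Ioi t, η < ν ∧ ν < δ := fun η hη => by
    obtain ⟨ν, hν, hlt, hνδ⟩ := h.2 (max η t) (max_lt hη ht)
    exact ⟨ν, ⟨hν, (le_max_right _ _).trans_lt hlt⟩, (le_max_left _ _).trans_lt hlt, hνδ⟩
  exact ⟨(key t ht).imp fun ν hν => ⟨hν.1, hν.2.2⟩, key⟩

end Club

/-! ### Club chains -/

variable {lam θ : Cardinal.{u}}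

/-- Pass through the successor of `α`: `C β` is almost contained in `C (α + 1)`, which lies inside
`accPoints (C α)`. -/
theorem IsClubChain.exists_mem_accPoints (hlam : lam.IsRegular)
    {C : CardSet θ → Set (CardSet lam)} (hC : IsClubChain lam θ C) {α β : CardSet θ}
    (h : α < β) : ∃ b, ∀ ξ ∈ C β, b < ξ → ξ ∈ accPoints (C α) := by
  have hcov : α ⋖ Order.succ α := Order.covBy_succ_of_not_isMax h.not_isMax
  have hacc := hC.2.2 _ _ hcov
  rcases (Order.succ_le_of_lt h).eq_or_lt with heq | hlt
  · obtain ⟨b, -⟩ := CardSet.exists_forall_lt_of_mk_lt hlam (s := ∅) (by simpa using hlam.pos)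
    exact ⟨b, fun ξ hξ _ => hacc (heq ▸ hξ)⟩
  · obtain ⟨b, hb⟩ := CardSet.exists_forall_lt_of_mk_lt hlam (hC.2.1 _ _ hlt)
    refine ⟨b, fun ξ hξ hbξ => hacc ?_⟩
    by_contra hn
    exact absurd (hb ξ ⟨hξ, hn⟩) hbξ.not_gt

/-- If the two clubs were equal, the least point above `b` would be a limit of smaller points of the
same club above `b`. -/
theorem IsClubChain.ne (hlam : lam.IsRegular) {C : CardSet θ → Set (CardSet lam)}
    (hC : IsClubChain lam θ C) {α β : CardSet θ} (h : α < β) : C α ≠ C β := fun heq => by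
  obtain ⟨b, hb⟩ := hC.exists_mem_accPoints hlam h
  rw [← heq] at hb
  have := noMaxOrder hlam.aleph0_le
  obtain ⟨b', hb'⟩ := exists_gt b
  obtain ⟨x, hx, hbx⟩ := (hC.1 α).isCofinal b'
  have hne : {x | x ∈ C α ∧ b < x}.Nonempty := ⟨x, hx, hb'.trans_le hbx⟩
  obtain ⟨y, hy, hmin⟩ := wellFounded_lt.has_min _ hne
  obtain ⟨ν, hν, hbν, hνy⟩ := (mem_accPoints_iff.1 (hb y hy.1 hy.2)).2 b hy.2
  exact hmin ν ⟨hν, hbν⟩ hνy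

/-- A sequence of clubs, each contained in the accumulation points of the former ones up to a
bounded set, can be trimmed to a club chain. -/
theorem exists_isClubChain (hlam : lam.IsRegular) (K : CardSet θ → Set (CardSet lam))
    (hK : ∀ α, IsClub (K α))
    (H : ∀ α β, α < β → ∃ γ, ∀ ξ ∈ K β, γ < ξ → ξ ∈ accPoints (K α)) :
    ∃ C, IsClubChain lam θ C := by
  classical
  have := noMaxOrder hlam.aleph0_le
  obtain ⟨z, -⟩ := CardSet.exists_forall_lt_of_mk_lt hlam (s := ∅) (by simpa using hlam.pos)
  have : Nonempty (CardSet lam) := ⟨z⟩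
  choose! γ hγ using H
  -- Only successor steps demand an exact inclusion, so the cut-off is updated there and restarts at
  -- `z` elsewhere; the other requirements tolerate bounded errors.
  let F : ∀ β : CardSet θ, (∀ α, α < β → CardSet lam) → CardSet lam := fun β t =>
    if h : ∃ α, α ⋖ β then max (t h.choose h.choose_spec.lt) (γ h.choose β) else z
  let t := (wellFounded_lt (α := CardSet θ)).fix F
  have ht : ∀ α β, α ⋖ β → t β = max (t α) (γ α β) := fun α β h => by
    have hex : ∃ α, α ⋖ β := ⟨α, h⟩
    have heq : hex.choose = α := hex.choose_spec.unique_left h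
    have : t β = F β fun α _ => t α := WellFounded.fix_eq _ _ _
    rw [this]
    simp only [F]
    rw [dif_pos hex, heq]
  refine ⟨fun α => K α ∩ Set.Ioi (t α), fun α => (hK α).inter_Ioi _, fun α β h => ?_,
    fun α β h ξ hξ => ?_⟩
  · refine CardSet.mk_lt_of_bddAbove hlam.aleph0_le ⟨max (γ α β) (t α), fun ξ hξ => ?_⟩
    by_contra hlt
    rw [not_le, max_lt_iff] at hlt
    exact hξ.2 ⟨(hK α).accPoints_subset (hγ α β h ξ hξ.1.1 hlt.1), hlt.2⟩
  · have hlt : max (t α) (γ α β) < ξ := ht α β h ▸ hξ.2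
    rw [max_lt_iff] at hlt
    exact mem_accPoints_inter_Ioi (hγ α β h.lt ξ hξ.1 hlt.2) hlt.1

/-! ### Lifting chains of clubs and of functions -/

namespace IsPowerSequence

variable {κ : Cardinal.{u}} {μs : CardSet κ → Cardinal.{u}} {μ : Cardinal.{u}}
  {D : Filter (CardSet κ)} {θs : CardSet κ → Cardinal.{u}}

/-- Club chains lift along a normal filter: take the closures of the sets of norms of functions
with values in the given clubs. -/
theorem exists_isClubChain (hP : IsPowerSequence κ μs μ) (hD : IsNormalFilter D)
    (hc : ∀ i, ∃ C, IsClubChain (Order.succ (μs i)) (θs i) C) (hθ : HasChain (ProdLT D θs) θ) :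
    ∃ C, IsClubChain (Order.succ μ) θ C := by
  classical
  choose C hC using hc
  obtain ⟨h, hh⟩ := hθ
  obtain ⟨f, -, hfn, -⟩ := hP.exists_scale hD
  let S : CardSet θ → Set (CardSet (Order.succ μ)) := fun α =>
    {x | ∃ g, (∀ᶠ i in D, g i ∈ C i (h α i)) ∧ hP.norm hD g = x}
  have hS : ∀ α, IsCofinal (S α) := fun α x => by
    choose g hg hle using fun i => ((hC i).1 (h α i)).isCofinal (f x i)
    exact ⟨_, ⟨g, .of_forall hg, rfl⟩, (hfn x).trans (hP.norm_mono hD (.of_forall hle))⟩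
  have hacc : ∀ α (g : ∀ i, CardSet (Order.succ (μs i))),
      (∀ᶠ i in D, g i ∈ accPoints (C i (h α i))) → hP.norm hD g ∈ accPoints (S α) := by
    intro α g hg
    rw [mem_accPoints_iff]
    constructor
    · have : ∀ i, ∃ y, g i ∈ accPoints (C i (h α i)) → y ∈ C i (h α i) ∧ y < g i := fun i => by
        by_cases hi : g i ∈ accPoints (C i (h α i))
        · obtain ⟨y, hy⟩ := (mem_accPoints_iff.1 hi).1
          exact ⟨y, fun _ => hy⟩
        · exact ⟨g i, fun h => absurd h hi⟩
      choose g' hg' using this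
      exact ⟨_, ⟨g', hg.mono fun i hi => (hg' i hi).1, rfl⟩,
        hP.norm_lt hD (hg.mono fun i hi => (hg' i hi).2)⟩
    · intro η hη
      -- Any ordinal below the norm of `g` is the norm of some `e <_D g`; choosing club points
      -- strictly between `e i` and `g i` gives a norm strictly in between.
      obtain ⟨e, he, rfl⟩ := hP.exists_norm_eq hD hη
      have : ∀ i, ∃ y, g i ∈ accPoints (C i (h α i)) → e i < g i →
          y ∈ C i (h α i) ∧ e i < y ∧ y < g i := fun i => by
        by_cases hi : g i ∈ accPoints (C i (h α i)) ∧ e i < g i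
        · obtain ⟨y, hy⟩ := (mem_accPoints_iff.1 hi.1).2 _ hi.2
          exact ⟨y, fun _ _ => hy⟩
        · exact ⟨g i, fun h h' => absurd ⟨h, h'⟩ hi⟩
      choose g' hg' using this
      have hall : ∀ᶠ i in D, g' i ∈ C i (h α i) ∧ e i < g' i ∧ g' i < g i := by
        filter_upwards [hg, he] with i hi hi' using hg' i hi hi'
      exact ⟨_, ⟨g', hall.mono fun i hi => hi.1, rfl⟩, hP.norm_lt hD (hall.mono fun i hi => hi.2.1),
        hP.norm_lt hD (hall.mono fun i hi => hi.2.2)⟩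
  have hSS : ∀ α β, α < β → ∃ γ, ∀ ξ ∈ S β, γ < ξ → ξ ∈ accPoints (S α) := fun α β hαβ => by
    have : ∀ i, ∃ b, h α i < h β i → ℵ₀ ≤ μs i →
        ∀ ξ ∈ C i (h β i), b < ξ → ξ ∈ accPoints (C i (h α i)) := fun i => by
      by_cases hi : h α i < h β i ∧ ℵ₀ ≤ μs i
      · obtain ⟨b, hb⟩ := (hC i).exists_mem_accPoints (Cardinal.isRegular_succ hi.2) hi.1
        exact ⟨b, fun _ _ => hb⟩
      · exact ⟨(nonempty_cardSet i).some, fun h h' => absurd ⟨h, h'⟩ hi⟩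
    choose b hb using this
    obtain ⟨γ, hγ⟩ := hP.exists_norm_bound hD b
    refine ⟨γ, ?_⟩
    rintro _ ⟨g, hg, rfl⟩ hlt
    refine hacc α g ?_
    filter_upwards [hh α β hαβ, hP.eventually_aleph0_le hD, hg, hγ g hlt.le] with i h₁ h₂ h₃ h₄
    exact hb i h₁ h₂ _ h₃ h₄
  refine _root_.exists_isClubChain hP.isRegular_succ (fun α => S α ∪ accPoints (S α))
    (fun α => isClub_union_accPoints (hS α)) fun α β hαβ => ?_
  obtain ⟨γ, hγ⟩ := hSS α β hαβ
  refine ⟨γ, fun ξ hξ hlt => ?_⟩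
  rcases hξ with hξ | hξ
  · exact accPoints_mono Set.subset_union_left (hγ ξ hξ hlt)
  -- An accumulation point of `S β` above `γ` is a limit of points of `S β` above `γ`, all of which
  -- lie in `accPoints (S α)`.
  · refine accPoints_mono Set.subset_union_right (accPoints_mono ?_
      (mem_accPoints_inter_Ioi hξ hlt))
    exact fun ν hν => hγ ν hν.1 hν.2

/-- Chains of functions modulo bounded sets lift along a normal filter. -/
theorem hasChain_funLT (hP : IsPowerSequence κ μs μ) (hD : IsNormalFilter D)
    (hc : ∀ i, HasChain (FunLT (Order.succ (μs i))) (θs i)) (hθ : HasChain (ProdLT D θs) θ) :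
    HasChain (FunLT (Order.succ μ)) θ := by
  choose a ha using hc
  obtain ⟨h, hh⟩ := hθ
  obtain ⟨f, -, -, hf⟩ := hP.exists_scale hD
  refine ⟨fun α ζ => hP.norm hD fun i => a i (h α i) (f ζ i), fun α β hαβ => ?_⟩
  have : ∀ i, ∃ b, h α i < h β i → ∀ x, b < x → a i (h α i) x < a i (h β i) x := fun i => by
    by_cases hi : h α i < h β i
    · obtain ⟨b, hb⟩ := ha i _ _ hi
      exact ⟨b, fun _ x hx => by_contra fun hn => absurd (hb hn) hx.not_ge⟩
    · exact ⟨(nonempty_cardSet i).some, fun h => absurd h hi⟩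
  choose b hb using this
  obtain ⟨s, hs⟩ := hf b
  refine ⟨s, fun ζ hζ => ?_⟩
  by_contra hlt
  refine hζ (hP.norm_lt hD ?_)
  filter_upwards [hh α β hαβ, hs ζ (not_le.1 hlt).le] with i h₁ h₂ using hb i h₁ _ h₂

end IsPowerSequence

/-! ### Lifting chains of sets -/

namespace IsPowerSequence

variable {κ : Cardinal.{u}} {μs : CardSet κ → Cardinal.{u}} {μ θ : Cardinal.{u}}
  {D : Filter (CardSet κ)} {θs : CardSet κ → Cardinal.{u}}

/-- There are `μ⁺` partial functions `g x`, each defined on a positive set `B x`, which are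
eventually large and which meet every product of unbounded sets arbitrarily high up. -/
theorem exists_partial_functions (hP : IsPowerSequence κ μs μ) (hD : IsNormalFilter D) :
    ∃ (T : Type u) (rk : T → CardSet (Order.succ μ)) (B : T → Set (CardSet κ))
      (g : T → ∀ i, CardSet (Order.succ (μs i))), #T ≤ Order.succ μ ∧
      (∀ s, #{x | rk x ≤ s} < Order.succ μ) ∧ (∀ x, ∃ᶠ i in D, i ∈ B x) ∧
      (∀ b : ∀ i, CardSet (Order.succ (μs i)), ∃ s, ∀ x, s < rk x →
        ∀ᶠ i in D, i ∈ B x → b i < g x i) ∧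
      ∀ P : ∀ i, Set (CardSet (Order.succ (μs i))), (∀ᶠ i in D, ¬ BddAbove (P i)) →
        ∀ s, ∃ x, s < rk x ∧ ∀ᶠ i in D, i ∈ B x → g x i ∈ P i := by
  classical
  have := hD.neBot
  obtain ⟨f, hmono, -, hcof⟩ := hP.exists_scale hD
  choose 𝒢 h𝒢 hfam using fun s => hP.exists_small_family (f s)
  have hG : ∀ s, ∃ G : CardSet μ → ∀ i, CardSet (Order.succ (μs i)), 𝒢 s ⊆ Set.range G :=
    fun s => by
    have hemb : Nonempty (𝒢 s ↪ CardSet μ) := by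
      rw [← Cardinal.le_def, mk_ord_toType]; exact h𝒢 s
    obtain ⟨e⟩ := hemb
    refine ⟨Function.extend e Subtype.val fun _ => f s, fun g hg => ⟨e ⟨g, hg⟩, ?_⟩⟩
    exact e.injective.extend_apply _ _ _
  choose G hG using hG
  -- Triples of a rank `t`, a positive set and a number of a function in the `t`-th small family,
  -- which must exceed all earlier `f r` almost everywhere on that set.
  let T := {x : CardSet (Order.succ μ) × (Set (CardSet κ) × CardSet μ) //
    (∃ᶠ i in D, i ∈ x.2.1) ∧
      ∀ t < x.1, ∀ᶠ i in D, i ∈ x.2.1 → f t i < G x.1 x.2.2 i}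
  have hcard : #(Set (CardSet κ) × CardSet μ) ≤ μ := by
    rw [mk_prod, lift_id, lift_id, mk_set, mk_ord_toType, mk_ord_toType]
    exact (mul_le_mul' hP.two_power_lt.le le_rfl).trans (mul_eq_self hP.aleph0_le).le
  refine ⟨T, fun x => x.1.1, fun x => x.1.2.1, fun x => G x.1.1 x.1.2.2, ?_, fun s => ?_,
    fun x => x.2.1, fun b => ?_, fun P hPu s => ?_⟩
  · refine (mk_subtype_le _).trans ?_
    rw [mk_prod, lift_id, lift_id, mk_ord_toType]
    exact (mul_le_mul' le_rfl (hcard.trans (Order.le_succ μ))).trans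
      (mul_eq_self hP.isRegular_succ.aleph0_le).le
  · rw [Order.lt_succ_iff]
    have hinj : Function.Injective (fun x : {x : T | x.1.1 ≤ s} =>
        ((⟨x.1.1.1, x.2⟩ : Set.Iic s), x.1.1.2)) := by
      intro x y hxy
      have h₁ := congrArg (fun p => p.1.1) hxy
      have h₂ := congrArg (fun p => p.2) hxy
      exact Subtype.ext (Subtype.ext (Prod.ext h₁ h₂))
    refine (mk_le_of_injective hinj).trans ?_
    rw [mk_prod, lift_id, lift_id]
    exact (mul_le_mul' (Order.lt_succ_iff.1 (CardSet.mk_Iic_lt hP.isRegular_succ.aleph0_le s))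
      hcard).trans (mul_eq_self hP.aleph0_le).le
  · obtain ⟨s, hs⟩ := hcof b
    refine ⟨s, fun x hx => ?_⟩
    filter_upwards [hs s le_rfl, x.2.2 s hx] with i h₁ h₂ hi using h₁.trans (h₂ hi)
  · have : ∀ i, ∃ y, ¬ BddAbove (P i) → y ∈ P i ∧ f s i < y := fun i => by
      by_cases hi : BddAbove (P i)
      · exact ⟨f s i, fun h => absurd hi h⟩
      · obtain ⟨y, hy⟩ := not_bddAbove_iff.1 hi (f s i)
        exact ⟨y, fun _ => hy⟩
    choose g hg using this
    have hex : {t | ¬ ProdLT D _ (f t) g}.Nonempty := by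
      obtain ⟨t, ht⟩ := hcof g
      refine ⟨t, fun hlt => ?_⟩
      obtain ⟨i, h₁, h₂⟩ := (hlt.and (ht t le_rfl)).exists
      exact h₁.not_gt h₂
    -- At the first `t` with `f t` not below `g`, the set where `g ≤ f t` is positive, while `g`
    -- exceeds every earlier `f r`. By Fodor some piece of that set is positive, and there `g`
    -- agrees with a coded function.
    obtain ⟨t, ht, hmin⟩ := wellFounded_lt.has_min _ hex
    replace hmin : ∀ r < t, ProdLT D _ (f r) g := fun r hr => by_contra fun hn => hmin r hn hr
    have hfs : ProdLT D _ (f s) g := hPu.mono fun i hi => (hg i hi).2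
    have hst : s < t := by
      by_contra hle
      rcases (not_lt.1 hle).eq_or_lt with rfl | hlt
      · exact ht hfs
      · exact ht ((hmono t s hlt).trans hfs)
    obtain ⟨h, G', hh, hG', hgG⟩ := hfam t D hD (fun i => min (g i) (f t i))
      (.of_forall fun i => min_le_right _ _)
    have hj : ∃ j, ∃ᶠ i in D, i ∈ {i | g i ≤ f t i ∧ h i = j} := by
      by_contra! hn
      refine ht (hD.eventually_of_regressive hh fun j => ?_)
      filter_upwards [hn j] with i hi hij
      exact not_le.1 fun hle => hi ⟨hle, hij⟩
    obtain ⟨j, hj⟩ := hj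
    obtain ⟨m, hm⟩ := hG t (hG' j)
    have heq : ∀ᶠ i in D, i ∈ {i | g i ≤ f t i ∧ h i = j} → G t m i = g i := by
      filter_upwards [hgG] with i hi hij
      rw [hm, ← hij.2, ← hi, min_eq_left hij.1]
    refine ⟨⟨(t, {i | g i ≤ f t i ∧ h i = j}, m), hj, fun r hr => ?_⟩, hst, ?_⟩
    · filter_upwards [heq, hmin r hr] with i h₁ h₂ hi
      rw [h₁ hi]; exact h₂
    · filter_upwards [heq, hPu] with i h₁ h₂ hi
      rw [h₁ hi]; exact (hg i h₂).1

/-- Chains of sets modulo bounded sets lift along a normal filter. -/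
theorem exists_isSetChain (hP : IsPowerSequence κ μs μ) (hD : IsNormalFilter D)
    (hc : ∀ i, ∃ A, IsSetChain (Order.succ (μs i)) (θs i) A) (hθ : HasChain (ProdLT D θs) θ) :
    ∃ A, IsSetChain (Order.succ μ) θ A := by
  choose A hA using hc
  obtain ⟨h, hh⟩ := hθ
  obtain ⟨T, rk, B, g, hT, hrk, hB, hlarge, hmeet⟩ := hP.exists_partial_functions hD
  have hemb : Nonempty (T ↪ CardSet (Order.succ μ)) := by
    rw [← Cardinal.le_def, mk_ord_toType]; exact hT
  obtain ⟨φ⟩ := hemb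
  have hreg := hP.isRegular_succ
  -- A bounded image would make `W` smaller than `μ⁺`, hence its ranks bounded by regularity.
  have hunb : ∀ W : Set T, (∀ s, ∃ x ∈ W, s < rk x) → ¬ BddAbove (φ '' W) := fun W hW hbdd => by
    rw [CardSet.bddAbove_iff_mk_lt hreg, mk_image_eq φ.injective] at hbdd
    obtain ⟨b, hb⟩ := CardSet.exists_forall_lt_of_mk_lt hreg
      (mk_image_le.trans_lt hbdd : #(rk '' W) < _)
    obtain ⟨x, hx, hbx⟩ := hW b
    exact absurd (hb _ ⟨x, hx, rfl⟩) hbx.not_gt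
  let A' : CardSet θ → Set T := fun α => {x | ∀ᶠ i in D, i ∈ B x → g x i ∈ A i (h α i)}
  refine ⟨fun α => φ '' A' α, fun α => hunb _ fun s => ?_, fun α β hαβ => ⟨?_, ?_⟩⟩
  · obtain ⟨x, hx, hxA⟩ := hmeet (fun i => A i (h α i)) (.of_forall fun i => (hA i).1 _) s
    exact ⟨x, hxA, hx⟩
  · rw [← Set.image_sdiff φ.injective]
    refine hunb _ fun s => ?_
    obtain ⟨x, hx, hxA⟩ := hmeet (fun i => A i (h β i) \ A i (h α i))
      ((hh α β hαβ).mono fun i hi => ((hA i).2 _ _ hi).1) s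
    refine ⟨x, ⟨hxA.mono fun i hi hiB => (hi hiB).1, fun hxα => ?_⟩, hx⟩
    -- Positivity of `B x` supplies a coordinate where both conditions really apply.
    obtain ⟨i, hiB, h₁, h₂⟩ := ((hB x).and_eventually (hxA.and hxα)).exists
    exact (h₁ hiB).2 (h₂ hiB)
  · have : ∀ i, ∃ b, h α i < h β i → ∀ y ∈ A i (h α i), b < y → y ∈ A i (h β i) := fun i => by
      by_cases hi : h α i < h β i
      · obtain ⟨b, hb⟩ := ((hA i).2 _ _ hi).2
        exact ⟨b, fun _ y hy hlt => by_contra fun hn => absurd (hb ⟨hy, hn⟩) hlt.not_ge⟩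
      · exact ⟨(nonempty_cardSet i).some, fun h => absurd h hi⟩
    choose b hb using this
    obtain ⟨s, hs⟩ := hlarge b
    rw [← Set.image_sdiff φ.injective, CardSet.bddAbove_iff_mk_lt hreg, mk_image_eq φ.injective]
    refine (mk_le_mk_of_subset fun x hx => ?_).trans_lt (hrk s)
    by_contra hlt
    refine hx.2 ?_
    filter_upwards [hh α β hαβ, hs x (not_le.1 hlt), hx.1] with i h₁ h₂ h₃ hi
    exact hb i h₁ _ (h₃ hi) (h₂ hi)

end IsPowerSequence

/-! ### Failing lengths exist, so the infima are not the default `0`; conclusion -/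

/-- Club chains have bounded length. -/
theorem exists_not_exists_isClubChain {lam : Cardinal.{u}} (hlam : lam.IsRegular) :
    ∃ χ, ¬ ∃ C : CardSet χ → Set (CardSet lam), IsClubChain lam χ C :=
  exists_not_exists_of_injective (fun χ => IsClubChain lam χ) fun _ _ hC _ _ h => hC.ne hlam h

theorem exists_not_hasChain_funLT {lam : Cardinal.{u}} (hlam : ℵ₀ ≤ lam) :
    ∃ χ, ¬ HasChain (FunLT lam) χ := by
  refine exists_not_exists_of_injective (fun χ a => ∀ α β : CardSet χ, α < β →
    FunLT lam (a α) (a β)) fun χ a ha α β h heq => CardSet.not_bddAbove_univ hlam ?_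
  simpa [FunLT, heq] using ha α β h

theorem exists_not_exists_isSetChain {lam : Cardinal.{u}} (hlam : lam.IsRegular) :
    ∃ χ, ¬ ∃ A : CardSet χ → Set (CardSet lam), IsSetChain lam χ A := by
  refine exists_not_exists_of_injective (fun χ => IsSetChain lam χ)
    fun χ A hA α β h heq => (hA.2 α β h).1 ?_
  rw [heq, Set.sdiff_self, CardSet.bddAbove_iff_mk_lt hlam]
  simpa using hlam.pos

theorem theorem5p4
    (κ : Cardinal.{u}) (hκ : κ.IsRegular) (hκ_unc : ℵ₀ < κ)
    (ℓ : ℕ) (hℓ : ℓ = 1 ∨ ℓ = 2 ∨ ℓ = 3)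
    (μs : CardSet κ → Cardinal.{u}) (μ : Cardinal.{u})
    (hμs_mono : StrictMono μs)
    (hμs_cont : ∀ i, Order.IsSuccLimit i → IsLUB (μs '' Set.Iio i) (μs i))
    (hμ : IsLUB (Set.range μs) μ)
    (hpow : 2 ^ κ < μ) (hμs_pow : ∀ i, μs i ^ κ < μ)
    (D : Filter (CardSet κ)) (hD : IsNormalFilter D)
    (θs : CardSet κ → Cardinal.{u}) (θ : Cardinal.{u})
    (hθs : ∀ i, θs i < dpPlus ℓ (Order.succ (μs i)))
    (hθ : IsTrueCofinality (ProdLT D θs) θ ∨ θ < depthPlus (ProdLT D θs)) :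
    θ < dpPlus ℓ (Order.succ μ) := by
  have hP : IsPowerSequence κ μs μ := ⟨hκ, hκ_unc, hμs_mono, hμs_cont, hμ, hpow, hμs_pow⟩
  have hchain : HasChain (ProdLT D θs) θ := by
    rcases hθ with ⟨-, a, ha, -⟩ | hθ
    · exact ⟨a, ha⟩
    · exact of_lt_sInf_not hθ
  rcases hℓ with rfl | rfl | rfl
  · exact lt_sInf_not (fun χ hχ => hP.exists_isClubChain hD (fun i => of_lt_sInf_not (hθs i))
      (hchain.mono hχ)) (exists_not_exists_isClubChain hP.isRegular_succ)
  · exact lt_sInf_not (fun χ hχ => hP.hasChain_funLT hD (fun i => of_lt_sInf_not (hθs i))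
      (hchain.mono hχ)) (exists_not_hasChain_funLT hP.isRegular_succ.aleph0_le)
  · exact lt_sInf_not (fun χ hχ => hP.exists_isSetChain hD (fun i => of_lt_sInf_not (hθs i))
      (hchain.mono hχ)) (exists_not_exists_isSetChain hP.isRegular_succ)
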